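/- Let $\mathbf k$ be a field of characteristic $0$ with pairwise commuting derivations $\delta_1,\dots,\delta_m$, let $Y=\{y_1,\dots,y_n\}$ be differential indeterminates, $\Theta$ the monoid of derivative operators $\delta_1^{k_1}\cdots\delta_m^{k_m}$, and $\mathbf k\{Y\}=\mathbf k[\Theta Y]$ the ring of differential polynomials. Fix a ranking on $\Theta Y$, i.e. a total order with $\theta u\ge u$ and $u\ge v\Rightarrow\theta u\ge\theta v$ for all $\theta\in\Theta$, $u,v\in\Theta Y$. The leader $u_f$ of $f\in\mathbf k\{Y\}\setminus\mathbf k$ is the highest derivative occurring in $f$; the rank of $f$ is $u_f^{\deg_{u_f}f}$; the initial of $f$ is its leading coefficient as a polynomial in $u_f$, and its separant is $\partial f/\partial u_f$. For $A\subset\mathbf k\{Y\}\setminus\mathbf k$, $H_A$ is the set of the initials and separants of the elements of $A$ and $\operatorname{ld}A$ is the set of their leaders. The set $A$ is autoreduced if for all distinct $f,g\in A$ no proper derivative of $u_g$ occurs in $f$ and $\deg_{u_g}f<\deg_{u_g}g$. Autoreduced sets (which are finite) are compared by listing the ranks of their elements increasingly: at the first difference the set with the smaller entry is lower, and a proper extension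 of a list is lower than the list. A characteristic set of a set $X\subset\mathbf k\{Y\}$ is an autoreduced subset of $X$ of lowest rank. $[F]$ denotes the differential ideal generated by $F$, and $J:S^\infty=\{a\mid sa\in J\text{ for some }s\in S^\infty\}$, where $S^\infty$ is the multiplicative set (containing $1$) generated by $S$. Let $C$ be a characteristic set of the differential ideal $I=[C]:H_C^\infty$, and let $\bar L$ be a differential prolongation of $L=\operatorname{ld}C$, i.e. $L\subseteq\bar L\subseteq\Theta L$ and $\Theta L\setminus\bar L$ is closed under every $\delta_i$. Put $N=\Theta Y\setminus\Theta L$ and, for an ideal $J$ of $\mathbf k\{Y\}$, let $\bar J_{\bar L}=J\cap\mathbf k[\bar L\cup N]$, an ideal of the polynomial ring $\mathbf k[\bar L\cup N]$. Let $I=P_1\cap\dots\cap P_s$ be the essential prime decomposition of $I$, i.e. the $P_i$ are prime differential ideals and $P_i\not\subseteq P_j$ for $i\ne j$. Then $$\bar I_{\bar L}=(\bar P_1)_{\bar L}\cap\dots\cap(\bar P_s)_{\bar L}$$ is the minimal prime decomposition of $\bar I_{\bar L}$: the ideals $(\bar P_i)_{\bar L}$ are prime, none of them contains another one, and they are exactly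 the minimal primes of $\bar I_{\bar L}$. -/

import Mathlib

namespace DiffAlg

/-- The derivatives `θ y_j` of `n` differential indeterminates with respect to `m` commuting
derivations: `(j, (k_1, …, k_m))` stands for `δ_1^{k_1} ⋯ δ_m^{k_m} y_j`. -/
abbrev DVar (n m : ℕ) := Fin n × (Fin m → ℕ)

/-- The action of the derivative operator `θ = δ_1^{k_1} ⋯ δ_m^{k_m}` on derivatives. -/
def act {n m : ℕ} (θ : Fin m → ℕ) (u : DVar n m) : DVar n m := (u.1, θ + u.2)

/-- The underlying ring of the ring `k{y_1, …, y_n}` of differential polynomials. -/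
abbrev DPoly (n m : ℕ) (k : Type*) [CommRing k] := MvPolynomial (DVar n m) k

section Derivations

variable {σ : Type*} {k : Type*} [CommRing k]

/-- Apply a derivation of the coefficient ring to every coefficient of a polynomial. -/
noncomputable def coeffDerivAux (d : Derivation ℤ k k) :
    MvPolynomial σ k →+ MvPolynomial σ k where
  toFun f := (AddMonoidAlgebra.coeff f).sum fun s a => MvPolynomial.monomial s (d a)
  map_zero' := by simp
  map_add' f g := by
    rw [AddMonoidAlgebra.coeff_add]
    exact Finsupp.sum_add_index' (by simp) (by simp)

theorem coeffDerivAux_monomial (d : Derivation ℤ k k) (s : σ →₀ ℕ) (a : k) :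
    coeffDerivAux d (MvPolynomial.monomial s a) = MvPolynomial.monomial s (d a) :=
  MvPolynomial.sum_monomial_eq (b := fun s a => MvPolynomial.monomial s (d a)) (by simp)

theorem coeffDerivAux_mul (d : Derivation ℤ k k) (f g : MvPolynomial σ k) :
    coeffDerivAux d (f * g) = f * coeffDerivAux d g + g * coeffDerivAux d f := by
  induction f using MvPolynomial.induction_on' with
  | add p q hp hq => rw [add_mul, map_add, map_add, hp, hq]; ring
  | monomial s a =>
    induction g using MvPolynomial.induction_on' with
    | add p q hp hq => rw [mul_add, map_add, map_add, hp, hq]; ring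
    | monomial t b =>
      simp only [MvPolynomial.monomial_mul, coeffDerivAux_monomial, Derivation.leibniz,
        smul_eq_mul, map_add]
      rw [add_comm t s]

/-- The derivation of a polynomial ring that acts by `d` on coefficients and kills all
variables. -/
noncomputable def coeffDeriv (d : Derivation ℤ k k) :
    Derivation ℤ (MvPolynomial σ k) (MvPolynomial σ k) :=
  Derivation.mk' (coeffDerivAux d).toIntLinearMap (coeffDerivAux_mul d)

/-- The derivation `δ_i` of `k{y_1, …, y_n}`: it extends the derivation `δ_i` of `k` and maps the
derivative `u` to `δ_i u`. -/
noncomputable def polyDeriv {n m : ℕ} (d : Fin m → Derivation ℤ k k) (i : Fin m) :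
    Derivation ℤ (DPoly n m k) (DPoly n m k) :=
  coeffDeriv (d i) +
    (MvPolynomial.mkDerivation k
      (fun u : DVar n m => (MvPolynomial.X (act (Pi.single i 1) u) : DPoly n m k))).restrictScalars ℤ

end Derivations

/-- A ranking on the set of derivatives. -/
structure Ranking (n m : ℕ) where
  le : DVar n m → DVar n m → Prop
  le_trans : ∀ u v w, le u v → le v w → le u w
  le_antisymm : ∀ u v, le u v → le v u → u = v
  le_total : ∀ u v, le u v ∨ le v u
  le_act : ∀ θ u, le u (act θ u)
  act_le_act : ∀ θ u v, le v u → le (act θ v) (act θ u)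

section Polynomials

variable {n m : ℕ} {k : Type*} [Field k]

/-- `u` is the leader of `f`: the derivative of the highest rank that appears in `f`. (A polynomial
has a leader, and then exactly one, iff it is not in `k`.) -/
def IsLeader (r : Ranking n m) (f : DPoly n m k) (u : DVar n m) : Prop :=
  u ∈ f.vars ∧ ∀ v ∈ f.vars, r.le v u

/-- The set of leaders of the elements of `A`. -/
def leaders (r : Ranking n m) (A : Set (DPoly n m k)) : Set (DVar n m) :=
  {u | ∃ f ∈ A, IsLeader r f u}

/-- The coefficient of `u ^ d` in `f`, when `f` is viewed as a univariate polynomial in `u`. -/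
noncomputable def coeffIn (u : DVar n m) (d : ℕ) (f : DPoly n m k) : DPoly n m k :=
  ∑ s ∈ f.support with s u = d, MvPolynomial.monomial (s.erase u) (MvPolynomial.coeff s f)

/-- The leading coefficient of `f`, when `f` is viewed as a univariate polynomial in `u`; it is the
initial of `f` if `u` is the leader of `f`. -/
noncomputable def initialAt (u : DVar n m) (f : DPoly n m k) : DPoly n m k :=
  coeffIn u (f.degreeOf u) f

/-- The set `H_A` of the initials and the separants `∂f/∂u_f` of the elements `f` of `A`. -/
def initSep (r : Ranking n m) (A : Set (DPoly n m k)) : Set (DPoly n m k) :=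
  {h | ∃ f ∈ A, ∃ u, IsLeader r f u ∧ (h = initialAt u f ∨ h = MvPolynomial.pderiv u f)}

/-- `f` is reduced with respect to `g` (for `g` not in `k`): no proper derivative of the leader `u`
of `g` appears in `f`, and `deg_u f < deg_u g`. -/
def IsReduced (r : Ranking n m) (f g : DPoly n m k) : Prop :=
  ∀ u, IsLeader r g u →
    (∀ θ : Fin m → ℕ, θ ≠ 0 → act θ u ∉ f.vars) ∧ f.degreeOf u < g.degreeOf u

/-- Autoreduced sets (these are always finite). -/
def IsAutoreduced (r : Ranking n m) (A : Finset (DPoly n m k)) : Prop :=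
  (∀ f ∈ A, f ∉ Set.range (MvPolynomial.C : k → DPoly n m k)) ∧
    ∀ f ∈ A, ∀ g ∈ A, f ≠ g → IsReduced r f g

/-- The pair `(u, d)` encodes the rank `u ^ d` of `f`. -/
def IsRank (r : Ranking n m) (f : DPoly n m k) (p : DVar n m × ℕ) : Prop :=
  IsLeader r f p.1 ∧ p.2 = f.degreeOf p.1

/-- The strict order on ranks `u ^ d`. -/
def rankLT (r : Ranking n m) (p q : DVar n m × ℕ) : Prop :=
  (r.le p.1 q.1 ∧ p.1 ≠ q.1) ∨ (p.1 = q.1 ∧ p.2 < q.2)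

/-- `l` is the list of the ranks of the elements of `A`, when these are arranged in the order of
increasing rank. -/
def IsRankSeq (r : Ranking n m) (A : Finset (DPoly n m k)) (l : List (DVar n m × ℕ)) : Prop :=
  l.Pairwise (rankLT r) ∧
    ∃ a : List (DPoly n m k), a.Nodup ∧ (∀ f, f ∈ a ↔ f ∈ A) ∧ List.Forall₂ (IsRank r) a l

/-- Comparison of increasing lists of ranks: at the first difference `l` has the smaller entry, or
`l` is a proper extension of `l'`. -/
def RankSeqLT (r : Ranking n m) (l l' : List (DVar n m × ℕ)) : Prop :=
  (∃ i, ∃ (h : i < l.length) (h' : i < l'.length),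
      (∀ j < i, l[j]? = l'[j]?) ∧ rankLT r l[i] l'[i]) ∨
    (l'.length < l.length ∧ ∀ j < l'.length, l[j]? = l'[j]?)

/-- `A` has lower rank than `B`. -/
def LowerRank (r : Ranking n m) (A B : Finset (DPoly n m k)) : Prop :=
  ∃ l l', IsRankSeq r A l ∧ IsRankSeq r B l' ∧ RankSeqLT r l l'

/-- `A` is a characteristic set (in Kolchin's sense) of `X`: an autoreduced subset of `X` of the
lowest rank. -/
def IsCharacteristicSet (r : Ranking n m) (X : Set (DPoly n m k)) (A : Finset (DPoly n m k)) :
    Prop :=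
  IsAutoreduced r A ∧ (A : Set (DPoly n m k)) ⊆ X ∧
    ∀ B : Finset (DPoly n m k), IsAutoreduced r B → (B : Set (DPoly n m k)) ⊆ X →
      ¬ LowerRank r B A

/-- Differential ideals of `k{y_1, …, y_n}`. -/
def IsDifferential (d : Fin m → Derivation ℤ k k) (I : Ideal (DPoly n m k)) : Prop :=
  ∀ i, ∀ f ∈ I, polyDeriv d i f ∈ I

/-- The differential ideal `[F]` generated by `F`. -/
noncomputable def diffSpan (d : Fin m → Derivation ℤ k k) (F : Set (DPoly n m k)) : Ideal (DPoly n m k) :=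
  sInf {J | IsDifferential d J ∧ F ⊆ J}

end Polynomials

/-- The saturated ideal `I : S^∞`, where `S^∞` is the multiplicative set generated by `S`. -/
def saturation {R : Type*} [CommRing R] (I : Ideal R) (S : Set R) : Ideal R where
  carrier := {a | ∃ s ∈ Submonoid.closure S, s * a ∈ I}
  zero_mem' := ⟨1, one_mem _, by simp⟩
  add_mem' := by
    rintro a b ⟨s, hs, ha⟩ ⟨t, ht, hb⟩
    refine ⟨s * t, mul_mem hs ht, ?_⟩
    have : s * t * (a + b) = t * (s * a) + s * (t * b) := by ring
    rw [this]
    exact I.add_mem (I.mul_mem_left _ ha) (I.mul_mem_left _ hb)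
  smul_mem' := by
    rintro c a ⟨s, hs, ha⟩
    refine ⟨s, hs, ?_⟩
    have : s * (c • a) = c * (s * a) := by rw [smul_eq_mul]; ring
    rw [this]
    exact I.mul_mem_left _ ha

/-- `Θ L`: all derivatives of the elements of `L`. -/
def thetaSet {n m : ℕ} (L : Set (DVar n m)) : Set (DVar n m) := {v | ∃ u ∈ L, ∃ θ, v = act θ u}

/-- `G` is a differential prolongation of `L`: `L ⊆ G ⊆ Θ L`, and `Θ L \ G` is invariant under
differentiation. -/
def IsProlongation {n m : ℕ} (L G : Set (DVar n m)) : Prop :=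
  L ⊆ G ∧ G ⊆ thetaSet L ∧
    ∀ v ∈ thetaSet L \ G, ∀ i : Fin m, act (Pi.single i 1) v ∈ thetaSet L \ G

/-- The set `G ∪ N` with `N = Θ Y \ Θ G`; for a differential prolongation `G` of `L` it is
`G ∪ (Θ Y \ Θ L)`, as `Θ G = Θ L`. -/
def prolongationVars {n m : ℕ} (G : Set (DVar n m)) : Set (DVar n m) := G ∪ (thetaSet G)ᶜ

/-- The prolongation ring `k[G ∪ N]`, a polynomial subring of `k{y_1, …, y_n}`. -/
noncomputable abbrev prolongationRing {n m : ℕ} (k : Type*) [Field k] (G : Set (DVar n m)) :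
    Subalgebra k (DPoly n m k) :=
  MvPolynomial.supported k (prolongationVars G)

/-- The prolongation ideal `I ∩ k[G ∪ N]`, an ideal of the prolongation ring `k[G ∪ N]`. -/
noncomputable def prolongationIdeal {n m : ℕ} {k : Type*} [Field k] (G : Set (DVar n m))
    (I : Ideal (DPoly n m k)) : Ideal (prolongationRing k G) :=
  I.comap (prolongationRing k G).val

/-- `I = P_1 ∩ … ∩ P_s` is the essential prime decomposition of `I`: the `P_i` are prime
differential ideals none of which contains another one. -/
def IsEssentialPrimeDecomposition {n m : ℕ} {k : Type*} [Field k] (d : Fin m → Derivation ℤ k k)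
    {s : ℕ} (I : Ideal (DPoly n m k)) (P : Fin s → Ideal (DPoly n m k)) : Prop :=
  (∀ i, (P i).IsPrime ∧ IsDifferential d (P i)) ∧ I = ⨅ i, P i ∧ ∀ i j, P i ≤ P j → i = j

/-- `J = Q_1 ∩ … ∩ Q_s` is the minimal prime decomposition of `J`: the `Q_i` are prime, none of
them contains another one, and they are the minimal primes of `J`. -/
def IsMinimalPrimeDecomposition {R : Type*} [CommRing R] {s : ℕ} (J : Ideal R)
    (Q : Fin s → Ideal R) : Prop :=
  (∀ i, (Q i).IsPrime) ∧ J = ⨅ i, Q i ∧ (∀ i j, Q i ≤ Q j → i = j) ∧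
    Set.range Q = J.minimalPrimes

end DiffAlg

/-! Partial Ritt reduction multiplies a differential polynomial by a product of separants of `C` and
brings it, modulo `[C]`, into the ring of the derivatives that are not proper derivatives of leaders
of `C`; this ring is contained in every prolongation ring. The separants are nonzerodivisors modulo
the saturated ideal `I`, so they lie in no minimal prime of `I`. Hence a minimal prime of `I` is
determined by its contraction to the prolongation ring, and inclusions between contractions lift. -/

namespace DiffAlg

section PrimeDecompositions

variable {R : Type*} [CommRing R]

theorem le_saturation (J : Ideal R) (S : Set R) : J ≤ saturation J S :=
  fun a ha => ⟨1, one_mem _, by rwa [one_mul]⟩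

theorem mem_saturation_of_mul_mem {J : Ideal R} {S : Set R} {h a : R}
    (hh : h ∈ Submonoid.closure S) (ha : h * a ∈ saturation J S) : a ∈ saturation J S := by
  obtain ⟨t, ht, hta⟩ := ha
  exact ⟨t * h, mul_mem ht hh, by rwa [mul_assoc]⟩

theorem notMem_of_mem_minimalPrimes_saturation {J p : Ideal R} {S : Set R}
    (hp : p ∈ (saturation J S).minimalPrimes) {h : R} (hh : h ∈ Submonoid.closure S) : h ∉ p := by
  intro hhp
  obtain ⟨a, ha, hha⟩ := Ideal.exists_mul_mem_of_mem_minimalPrimes hp hhp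
  exact ha (mem_saturation_of_mul_mem hh hha)

theorem isMinimalPrimeDecomposition_of_incomparable {s : ℕ} {J : Ideal R} {Q : Fin s → Ideal R}
    (hprime : ∀ i, (Q i).IsPrime) (hinf : J = ⨅ i, Q i) (hinc : ∀ i j, Q i ≤ Q j → i = j) :
    IsMinimalPrimeDecomposition J Q := by
  have hJQ : ∀ i, J ≤ Q i := fun i => hinf ▸ iInf_le Q i
  have exists_le : ∀ p : Ideal R, p.IsPrime → J ≤ p → ∃ i, Q i ≤ p := by
    intro p hp hJp
    rw [hinf, ← Finset.inf_univ_eq_iInf] at hJp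
    obtain ⟨i, -, hi⟩ := hp.inf_le'.1 hJp
    exact ⟨i, hi⟩
  refine ⟨hprime, hinf, hinc, Set.Subset.antisymm ?_ ?_⟩
  · rintro _ ⟨i, rfl⟩
    refine ⟨⟨hprime i, hJQ i⟩, ?_⟩
    rintro p ⟨hp, hJp⟩ hpi
    obtain ⟨j, hj⟩ := exists_le p hp hJp
    obtain rfl := hinc j i (hj.trans hpi)
    exact hj
  · rintro p ⟨⟨hp, hJp⟩, hmin⟩
    obtain ⟨i, hi⟩ := exists_le p hp hJp
    exact ⟨i, le_antisymm hi (hmin ⟨hprime i, hJQ i⟩ hi)⟩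

variable {A : Type*} [CommRing A]

theorem le_of_comap_le_comap {F : Type*} [FunLike F A R] [RingHomClass F A R] {φ : F}
    {P Q : Ideal R} (hQ : Q.IsPrime) (hred : ∀ f, ∃ h ∉ Q, ∃ a, h * f - φ a ∈ P ⊓ Q)
    (hle : P.comap φ ≤ Q.comap φ) : P ≤ Q := by
  intro f hf
  obtain ⟨h, hhQ, a, haP, haQ⟩ := hred f
  have haφP : φ a ∈ P := (Submodule.sub_mem_iff_right P (P.mul_mem_left h hf)).1 haP
  have haφQ : φ a ∈ Q := hle haφP
  have hhf : h * f ∈ Q := (Submodule.sub_mem_iff_left Q haφQ).1 haQ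
  exact (hQ.mem_or_mem hhf).resolve_left hhQ

theorem IsMinimalPrimeDecomposition.comap {F : Type*} [FunLike F A R] [RingHomClass F A R]
    {s : ℕ} {J : Ideal R} {P : Fin s → Ideal R} (hP : IsMinimalPrimeDecomposition J P) (φ : F)
    (hred : ∀ f, ∃ h, (∀ i, h ∉ P i) ∧ ∃ a, h * f - φ a ∈ J) :
    IsMinimalPrimeDecomposition (J.comap φ) fun i => (P i).comap φ := by
  obtain ⟨hprime, rfl, hinc, -⟩ := hP
  refine isMinimalPrimeDecomposition_of_incomparable (fun i => (hprime i).comap φ)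
    (Ideal.comap_iInf φ P) fun i j hij => hinc i j ?_
  refine le_of_comap_le_comap (hprime j) (fun f => ?_) hij
  obtain ⟨h, hh, a, ha⟩ := hred f
  exact ⟨h, hh j, a, iInf_le P i ha, iInf_le P j ha⟩

end PrimeDecompositions

section MultiIndices

variable {ι : Type*} [DecidableEq ι]

theorem exists_eq_single_add {θ : ι → ℕ} (hθ : θ ≠ 0) :
    ∃ (i : ι) (φ : ι → ℕ), θ = Pi.single i 1 + φ := by
  obtain ⟨i, hi⟩ := Function.ne_iff.1 hθ
  refine ⟨i, θ - Pi.single i 1, (add_tsub_cancel_of_le ?_).symm⟩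
  exact update_le_iff.2 ⟨Nat.one_le_iff_ne_zero.2 hi, fun j _ => Nat.zero_le (θ j)⟩

theorem multiIndex_induction [Finite ι] {p : (ι → ℕ) → Prop} (zero : p 0)
    (single_add : ∀ i φ, p φ → p (Pi.single i 1 + φ)) (θ : ι → ℕ) : p θ := by
  induction θ using WellFoundedLT.induction with
  | ind θ ih =>
    by_cases hθ : θ = 0
    · exact hθ ▸ zero
    · obtain ⟨i, φ, rfl⟩ := exists_eq_single_add hθ
      exact single_add i φ (ih φ (lt_add_of_pos_left φ (by simp)))

end MultiIndices

section Rankings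

variable {n m : ℕ}

theorem act_act (θ φ : Fin m → ℕ) (u : DVar n m) : act θ (act φ u) = act (θ + φ) u := by
  simp only [act, add_assoc]

theorem act_zero (u : DVar n m) : act 0 u = u := by
  simp only [act, zero_add]

theorem act_injective (θ : Fin m → ℕ) : Function.Injective (act θ : DVar n m → DVar n m) := by
  rintro ⟨a, b⟩ ⟨a', b'⟩ h
  simpa [act] using h

theorem act_ne_self {θ : Fin m → ℕ} (hθ : θ ≠ 0) (u : DVar n m) : act θ u ≠ u := by
  simpa [act, Prod.ext_iff] using hθ

namespace Ranking

variable (r : Ranking n m)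

/-- The strict order of a ranking. -/
def lt (u v : DVar n m) : Prop := r.le u v ∧ ¬ r.le v u

variable {r}

theorem lt_of_le_of_ne {u v : DVar n m} (h : r.le u v) (hne : u ≠ v) : r.lt u v :=
  ⟨h, fun h' => hne (r.le_antisymm u v h h')⟩

theorem lt_of_le_of_lt {u v w : DVar n m} (h : r.le u v) (h' : r.lt v w) : r.lt u w :=
  ⟨r.le_trans u v w h h'.1, fun hwu => h'.2 (r.le_trans w u v hwu h)⟩

theorem lt_of_lt_of_le {u v w : DVar n m} (h : r.lt u v) (h' : r.le v w) : r.lt u w :=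
  ⟨r.le_trans u v w h.1 h', fun hwu => h.2 (r.le_trans v w u h' hwu)⟩

theorem lt_act {θ : Fin m → ℕ} (hθ : θ ≠ 0) (u : DVar n m) : r.lt u (act θ u) :=
  lt_of_le_of_ne (r.le_act θ u) (act_ne_self hθ u).symm

theorem act_lt_act (θ : Fin m → ℕ) {u v : DVar n m} (h : r.lt u v) :
    r.lt (act θ u) (act θ v) := by
  refine lt_of_le_of_ne (r.act_le_act θ v u h.1) fun heq => h.2 ?_
  rw [act_injective θ heq]
  exact (r.le_total v v).elim id id

theorem wellQuasiOrdered_le (r : Ranking n m) : WellQuasiOrdered r.le := by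
  intro f
  have hdickson := (Finite.wellQuasiOrdered (α := Fin n) (· = ·)).prod
    (_root_.wellQuasiOrdered_le (α := Fin m → ℕ))
  obtain ⟨i, j, hij, hfst, hsnd⟩ := hdickson f
  have hact : f j = act ((f j).2 - (f i).2) (f i) :=
    Prod.ext hfst.symm (tsub_add_cancel_of_le hsnd).symm
  exact ⟨i, j, hij, hact ▸ r.le_act _ (f i)⟩

theorem wellFounded_lt (r : Ranking n m) : WellFounded r.lt :=
  have : IsPreorder (DVar n m) r.le :=
    { refl := fun u => (r.le_total u u).elim id id
      trans := r.le_trans }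
  r.wellQuasiOrdered_le.wellFounded

end Ranking

end Rankings

section SupportedDerivations

open MvPolynomial

variable {σ S k : Type*} [CommSemiring S] [CommSemiring k] [Algebra S (MvPolynomial σ k)]

theorem X_mem_supported_of_mem {V : Set σ} {v : σ} (hv : v ∈ V) :
    (X v : MvPolynomial σ k) ∈ supported k V :=
  Algebra.subset_adjoin (Set.mem_image_of_mem X hv)

theorem derivation_mem_supported {V W : Set σ} (hVW : V ⊆ W)
    (D : Derivation S (MvPolynomial σ k) (MvPolynomial σ k))
    (hC : ∀ a, D (C a) ∈ supported k W) (hX : ∀ v ∈ V, D (X v) ∈ supported k W)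
    {f : MvPolynomial σ k} (hf : f ∈ supported k V) : D f ∈ supported k W := by
  have hle : supported k V ≤ supported k W := supported_mono hVW
  rw [supported] at hf
  induction hf using Algebra.adjoin_induction with
  | mem x hx =>
    obtain ⟨v, hv, rfl⟩ := hx
    exact hX v hv
  | algebraMap a => exact hC a
  | add f g _ _ hf hg => rw [map_add]; exact add_mem hf hg
  | mul f g hfV hgV hf hg =>
    rw [Derivation.leibniz, smul_eq_mul, smul_eq_mul]
    exact add_mem (mul_mem (hle hfV) hg) (mul_mem (hle hgV) hf)

theorem pderiv_mem_supported {V : Set σ} (u : σ) {f : MvPolynomial σ k}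
    (hf : f ∈ supported k V) : pderiv u f ∈ supported k V := by
  classical
  refine derivation_mem_supported subset_rfl (pderiv u) (fun a => ?_) (fun v _ => ?_) hf
  · rw [pderiv_C]
    exact zero_mem _
  · rw [pderiv_X, Pi.single_apply]
    split_ifs
    exacts [one_mem _, zero_mem _]

end SupportedDerivations

section Derivatives

open MvPolynomial

variable {n m : ℕ}

section CommRing

variable {k : Type*} [CommRing k] (d : Fin m → Derivation ℤ k k) (i : Fin m)

theorem polyDeriv_C (a : k) : polyDeriv d i (C a : DPoly n m k) = C (d i a) := by
  have h : coeffDeriv (σ := DVar n m) (d i) (C a) = C (d i a) := coeffDerivAux_monomial (d i) 0 a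
  simp [polyDeriv, h]

theorem polyDeriv_X (u : DVar n m) :
    polyDeriv d i (X u : DPoly n m k) = X (act (Pi.single i 1) u) := by
  have h : coeffDeriv (σ := DVar n m) (d i) (X u) = 0 :=
    (coeffDerivAux_monomial (d i) (Finsupp.single u 1) 1).trans (by simp)
  simp [polyDeriv, h, mkDerivation_X]

/-- The polynomials in the derivatives of lower rank than `v`; this is where the tail of a
polynomial with leader `v` lives when the polynomial is linear in `v`. -/
noncomputable abbrev lowerRing (k : Type*) [CommRing k] (r : Ranking n m) (v : DVar n m) :
    Subalgebra k (DPoly n m k) :=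
  supported k {w | r.lt w v}

variable {r : Ranking n m}

theorem lowerRing_mono {u v : DVar n m} (h : r.le u v) : lowerRing k r u ≤ lowerRing k r v :=
  supported_mono fun _ hw => Ranking.lt_of_lt_of_le hw h

theorem polyDeriv_mem_lowerRing {v : DVar n m} {f : DPoly n m k} (hf : f ∈ lowerRing k r v) :
    polyDeriv d i f ∈ lowerRing k r (act (Pi.single i 1) v) := by
  refine derivation_mem_supported (fun w hw => Ranking.lt_of_lt_of_le hw (r.le_act _ v)) _
    (fun a => ?_) (fun w hw => ?_) hf
  · rw [polyDeriv_C]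
    exact Subalgebra.algebraMap_mem _ (d i a)
  · rw [polyDeriv_X]
    exact X_mem_supported_of_mem (Ranking.act_lt_act _ hw)

theorem polyDeriv_sub_mul_X_mem_lowerRing {v : DVar n m} {g s : DPoly n m k}
    (hs : s ∈ lowerRing k r v) (hg : g - s * X v ∈ lowerRing k r v) :
    polyDeriv d i g - s * X (act (Pi.single i 1) v) ∈
      lowerRing k r (act (Pi.single i 1) v) := by
  have hX : (X v : DPoly n m k) ∈ lowerRing k r (act (Pi.single i 1) v) :=
    X_mem_supported_of_mem (Ranking.lt_act (by simp) v)
  have hleibniz : polyDeriv d i g - s * X (act (Pi.single i 1) v) =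
      polyDeriv d i (g - s * X v) + X v * polyDeriv d i s := by
    rw [map_sub, Derivation.leibniz, polyDeriv_X, smul_eq_mul, smul_eq_mul]
    ring
  rw [hleibniz]
  exact add_mem (polyDeriv_mem_lowerRing d i hg) (mul_mem hX (polyDeriv_mem_lowerRing d i hs))

theorem polyDeriv_sub_pderiv_mul_X_mem_lowerRing {u : DVar n m} {f : DPoly n m k}
    (hf : f ∈ supported k {w | r.le w u}) :
    polyDeriv d i f - pderiv u f * X (act (Pi.single i 1) u) ∈
      lowerRing k r (act (Pi.single i 1) u) := by
  classical
  have hlt : r.lt u (act (Pi.single i 1) u) := Ranking.lt_act (by simp) u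
  -- `f ↦ δ_i f - (∂f/∂u) δ_i u` is itself a derivation, so it suffices to test it on variables.
  let D : Derivation ℤ (DPoly n m k) (DPoly n m k) :=
    polyDeriv d i -
      (X (act (Pi.single i 1) u) : DPoly n m k) • (pderiv (R := k) u).restrictScalars ℤ
  have hD : ∀ g, D g = polyDeriv d i g - pderiv u g * X (act (Pi.single i 1) u) := fun g => by
    simp [D, mul_comm]
  rw [← hD]
  refine derivation_mem_supported (fun w hw => Ranking.lt_of_le_of_lt hw hlt) D
    (fun a => ?_) (fun w hw => ?_) hf
  · rw [hD, polyDeriv_C, pderiv_C, zero_mul, sub_zero]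
    exact Subalgebra.algebraMap_mem _ (d i a)
  · rw [hD, polyDeriv_X]
    obtain rfl | hwu := eq_or_ne w u
    · rw [pderiv_X_self, one_mul, sub_self]
      exact zero_mem _
    · rw [pderiv_X_of_ne hwu, zero_mul, sub_zero]
      exact X_mem_supported_of_mem (Ranking.act_lt_act _ (Ranking.lt_of_le_of_ne hw hwu))

end CommRing

variable {k : Type*} [Field k] {d : Fin m → Derivation ℤ k k} {r : Ranking n m}
  {J : Ideal (DPoly n m k)}

theorem IsDifferential.exists_sub_mul_X_act_mem_lowerRing (hJ : IsDifferential d J)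
    {v : DVar n m} {g s : DPoly n m k} (hgJ : g ∈ J) (hs : s ∈ lowerRing k r v)
    (hg : g - s * X v ∈ lowerRing k r v) (θ : Fin m → ℕ) :
    ∃ q ∈ J, q - s * X (act θ v) ∈ lowerRing k r (act θ v) := by
  induction θ using multiIndex_induction with
  | zero =>
    rw [act_zero]
    exact ⟨g, hgJ, hg⟩
  | single_add i φ ih =>
    obtain ⟨q, hqJ, hq⟩ := ih
    rw [← act_act]
    exact ⟨polyDeriv d i q, hJ i q hqJ,
      polyDeriv_sub_mul_X_mem_lowerRing d i (lowerRing_mono (r.le_act φ v) hs) hq⟩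

theorem IsDifferential.exists_sub_separant_mul_X_act_mem_lowerRing (hJ : IsDifferential d J)
    {u : DVar n m} {f : DPoly n m k} (hfJ : f ∈ J) (hf : f ∈ supported k {w | r.le w u})
    {θ : Fin m → ℕ} (hθ : θ ≠ 0) :
    ∃ q ∈ J, q - pderiv u f * X (act θ u) ∈ lowerRing k r (act θ u) := by
  obtain ⟨i, φ, rfl⟩ := exists_eq_single_add hθ
  have hsep : pderiv u f ∈ lowerRing k r (act (Pi.single i 1) u) :=
    supported_mono (fun w hw => Ranking.lt_of_le_of_lt hw (Ranking.lt_act (by simp) u))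
      (pderiv_mem_supported u hf)
  rw [add_comm, ← act_act]
  exact hJ.exists_sub_mul_X_act_mem_lowerRing (hJ i f hfJ) hsep
    (polyDeriv_sub_pderiv_mul_X_mem_lowerRing d i hf) φ

variable (d)

theorem isDifferential_diffSpan (F : Set (DPoly n m k)) : IsDifferential d (diffSpan d F) := by
  intro i f hf
  rw [diffSpan, Submodule.mem_sInf] at hf ⊢
  exact fun J hJ => hJ.1 i f (hf J hJ)

theorem subset_diffSpan (F : Set (DPoly n m k)) : F ⊆ (diffSpan d F : Set (DPoly n m k)) :=
  fun _ hf => Submodule.mem_sInf.2 fun _ hJ => hJ.2 hf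

end Derivatives

section Reduction

open MvPolynomial

/-- The elements of `A` that, after multiplication by an element of the multiplicative set `M`,
are congruent modulo `J` to an element of the subalgebra `B`. They form a subalgebra because
`M` is contained in `B`. -/
def reducibleTo {R A : Type*} [CommRing R] [CommRing A] [Algebra R A] (J : Ideal A)
    (M : Submonoid A) (B : Subalgebra R A) (hMB : M ≤ B.toSubmonoid) : Subalgebra R A where
  carrier := {f | ∃ h ∈ M, ∃ b ∈ B, h * f - b ∈ J}
  mul_mem' := by
    rintro f g ⟨h, hh, b, hb, hf⟩ ⟨h', hh', b', hb', hg⟩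
    refine ⟨h * h', mul_mem hh hh', b * b', mul_mem hb hb', ?_⟩
    have : h * h' * (f * g) - b * b' = h' * g * (h * f - b) + b * (h' * g - b') := by ring
    rw [this]
    exact add_mem (J.mul_mem_left _ hf) (J.mul_mem_left _ hg)
  add_mem' := by
    rintro f g ⟨h, hh, b, hb, hf⟩ ⟨h', hh', b', hb', hg⟩
    refine ⟨h * h', mul_mem hh hh', h' * b + h * b',
      add_mem (mul_mem (hMB hh') hb) (mul_mem (hMB hh) hb'), ?_⟩
    have : h * h' * (f + g) - (h' * b + h * b') = h' * (h * f - b) + h * (h' * g - b') := by ring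
    rw [this]
    exact add_mem (J.mul_mem_left _ hf) (J.mul_mem_left _ hg)
  algebraMap_mem' a := ⟨1, one_mem _, _, B.algebraMap_mem a, by simp⟩

variable {n m : ℕ}

/-- The derivatives that are not proper derivatives of elements of `L`: the variables that may
remain after a partial reduction with respect to polynomials with leaders in `L`. -/
def partiallyReducedVars (L : Set (DVar n m)) : Set (DVar n m) :=
  {v | ∀ u ∈ L, ∀ θ : Fin m → ℕ, θ ≠ 0 → v ≠ act θ u}

theorem partiallyReducedVars_subset_prolongationVars {L G : Set (DVar n m)} (hLG : L ⊆ G)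
    (hG : G ⊆ thetaSet L) : partiallyReducedVars L ⊆ prolongationVars G := by
  intro v hv
  refine or_iff_not_imp_right.2 fun hvG => ?_
  obtain ⟨w, hw, θ, rfl⟩ := not_not.1 hvG
  obtain ⟨u, hu, φ, rfl⟩ := hG hw
  rw [act_act] at hv ⊢
  have hθφ : θ + φ = 0 := not_not.1 fun hne => hv u hu (θ + φ) hne rfl
  rw [hθφ, act_zero]
  exact hLG hu

variable {k : Type*} [Field k]

/-- The separants of the elements of `A`. -/
def separants (r : Ranking n m) (A : Set (DPoly n m k)) : Set (DPoly n m k) :=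
  {h | ∃ f ∈ A, ∃ u, IsLeader r f u ∧ h = pderiv u f}

/-- Partially autoreduced sets, the sets that allow a partial reduction: no proper derivative of
the leader of an element appears in another element. -/
def IsPartiallyAutoreduced (r : Ranking n m) (A : Set (DPoly n m k)) : Prop :=
  A.Pairwise fun f g => ∀ u, IsLeader r g u → ∀ θ : Fin m → ℕ, θ ≠ 0 → act θ u ∉ f.vars

/-- The ring of the polynomials that are partially reduced with respect to `A`: no proper
derivative of a leader of an element of `A` appears in them. -/
noncomputable abbrev partiallyReducedRing (r : Ranking n m) (A : Set (DPoly n m k)) :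
    Subalgebra k (DPoly n m k) :=
  supported k (partiallyReducedVars (leaders r A))

variable {r : Ranking n m} {A : Set (DPoly n m k)}

theorem separants_subset_initSep : separants r A ⊆ initSep r A := by
  rintro _ ⟨f, hf, u, hu, rfl⟩
  exact ⟨f, hf, u, hu, Or.inr rfl⟩

theorem IsAutoreduced.isPartiallyAutoreduced {A : Finset (DPoly n m k)}
    (hA : IsAutoreduced r A) : IsPartiallyAutoreduced r (A : Set (DPoly n m k)) :=
  fun f hf g hg hfg u hu => (hA.2 f hf g hg hfg u hu).1

theorem IsLeader.act_notMem_vars {f : DPoly n m k} {u : DVar n m} (hu : IsLeader r f u)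
    {θ : Fin m → ℕ} (hθ : θ ≠ 0) : act θ u ∉ f.vars :=
  fun hmem => (Ranking.lt_act hθ u).2 (hu.2 _ hmem)

namespace IsPartiallyAutoreduced

variable (hA : IsPartiallyAutoreduced r A)

include hA

theorem mem_partiallyReducedRing {f : DPoly n m k} (hf : f ∈ A) :
    f ∈ partiallyReducedRing r A := by
  rw [mem_supported]
  rintro v hv u ⟨g, hg, hu⟩ θ hθ rfl
  obtain rfl | hfg := eq_or_ne f g
  · exact hu.act_notMem_vars hθ hv
  · exact hA hf hg hfg u hu θ hθ hv

theorem closure_separants_le :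
    Submonoid.closure (separants r A) ≤ (partiallyReducedRing r A).toSubmonoid := by
  rw [Submonoid.closure_le]
  rintro _ ⟨f, hf, u, -, rfl⟩
  exact pderiv_mem_supported u (hA.mem_partiallyReducedRing hf)

variable {d : Fin m → Derivation ℤ k k} {J : Ideal (DPoly n m k)} (hJ : IsDifferential d J)
  (hAJ : A ⊆ J)

include hJ hAJ

theorem X_mem_reducibleTo (v : DVar n m) :
    (X v : DPoly n m k) ∈ reducibleTo J (Submonoid.closure (separants r A))
      (partiallyReducedRing r A) hA.closure_separants_le := by
  induction v using r.wellFounded_lt.induction with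
  | _ v ih =>
  by_cases hv : v ∈ partiallyReducedVars (leaders r A)
  · exact ⟨1, one_mem _, X v, X_mem_supported_of_mem hv, by simp⟩
  simp only [partiallyReducedVars, Set.mem_ofPred_eq, not_forall, not_not] at hv
  obtain ⟨u, ⟨f, hf, hu⟩, θ, hθ, rfl⟩ := hv
  obtain ⟨q, hqJ, htail⟩ := hJ.exists_sub_separant_mul_X_act_mem_lowerRing (hAJ hf)
    (mem_supported.2 hu.2) hθ
  have hlower : lowerRing k r (act θ u) ≤ reducibleTo J (Submonoid.closure (separants r A))
      (partiallyReducedRing r A) hA.closure_separants_le := by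
    rw [lowerRing, supported, Algebra.adjoin_le_iff]
    rintro _ ⟨w, hw, rfl⟩
    exact ih w hw
  obtain ⟨h, hh, b, hb, hred⟩ := hlower htail
  have hsep : pderiv u f ∈ Submonoid.closure (separants r A) :=
    Submonoid.subset_closure ⟨f, hf, u, hu, rfl⟩
  refine ⟨h * pderiv u f, mul_mem hh hsep, -b, neg_mem hb, ?_⟩
  have hsplit : h * pderiv u f * X (act θ u) - -b =
      h * q - (h * (q - pderiv u f * X (act θ u)) - b) := by ring
  rw [hsplit]
  exact sub_mem (J.mul_mem_left h hqJ) hred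

theorem exists_partial_reduction (f : DPoly n m k) :
    ∃ h ∈ Submonoid.closure (separants r A), ∃ g ∈ partiallyReducedRing r A, h * f - g ∈ J := by
  have htop : reducibleTo J (Submonoid.closure (separants r A)) (partiallyReducedRing r A)
      hA.closure_separants_le = ⊤ := by
    rw [← top_le_iff, ← adjoin_range_X, Algebra.adjoin_le_iff]
    rintro _ ⟨v, rfl⟩
    exact hA.X_mem_reducibleTo hJ hAJ v
  exact htop.ge (Algebra.mem_top (x := f))

end IsPartiallyAutoreduced

theorem IsEssentialPrimeDecomposition.isMinimalPrimeDecomposition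
    {d : Fin m → Derivation ℤ k k} {s : ℕ} {I : Ideal (DPoly n m k)}
    {P : Fin s → Ideal (DPoly n m k)} (hP : IsEssentialPrimeDecomposition d I P) :
    IsMinimalPrimeDecomposition I P :=
  isMinimalPrimeDecomposition_of_incomparable (fun i => (hP.1 i).1) hP.2.1 hP.2.2

end Reduction

end DiffAlg

open DiffAlg in
theorem lemmal_general {n m : ℕ} {k : Type*} [Field k] {d : Fin m → Derivation ℤ k k}
    {r : Ranking n m} {A H : Set (DPoly n m k)} (hA : IsPartiallyAutoreduced r A)
    (hH : separants r A ⊆ H) {J : Ideal (DPoly n m k)} (hJ : IsDifferential d J) (hAJ : A ⊆ J)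
    {G : Set (DVar n m)} (hAG : leaders r A ⊆ G) (hGA : G ⊆ thetaSet (leaders r A))
    {s : ℕ} {P : Fin s → Ideal (DPoly n m k)}
    (hP : IsMinimalPrimeDecomposition (saturation J H) P) :
    IsMinimalPrimeDecomposition (prolongationIdeal G (saturation J H))
      fun i => prolongationIdeal G (P i) := by
  refine hP.comap (prolongationRing k G).val fun f => ?_
  obtain ⟨h, hh, g, hg, hfg⟩ := hA.exists_partial_reduction hJ hAJ f
  have hgG : g ∈ prolongationRing k G :=
    MvPolynomial.supported_mono (partiallyReducedVars_subset_prolongationVars hAG hGA) hg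
  refine ⟨h, fun i => ?_, ⟨g, hgG⟩, le_saturation J H hfg⟩
  have hPi : P i ∈ (saturation J H).minimalPrimes := hP.2.2.2 ▸ Set.mem_range_self i
  exact notMem_of_mem_minimalPrimes_saturation hPi (Submonoid.closure_mono hH hh)

theorem lemmal {n m : ℕ} {k : Type*} [Field k] [CharZero k]
    (d : Fin m → Derivation ℤ k k) (hd : ∀ i j a, d i (d j a) = d j (d i a))
    (r : DiffAlg.Ranking n m)
    (I : Ideal (DiffAlg.DPoly n m k)) (C : Finset (DiffAlg.DPoly n m k))
    (hC : DiffAlg.IsCharacteristicSet r (I : Set (DiffAlg.DPoly n m k)) C)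
    (hI : I = DiffAlg.saturation (DiffAlg.diffSpan d (C : Set (DiffAlg.DPoly n m k)))
      (DiffAlg.initSep r (C : Set (DiffAlg.DPoly n m k))))
    (Lbar : Set (DiffAlg.DVar n m))
    (hL : DiffAlg.IsProlongation
      (DiffAlg.leaders r (C : Set (DiffAlg.DPoly n m k))) Lbar)
    (s : ℕ) (P : Fin s → Ideal (DiffAlg.DPoly n m k))
    (hP : DiffAlg.IsEssentialPrimeDecomposition d I P) :
    DiffAlg.IsMinimalPrimeDecomposition (DiffAlg.prolongationIdeal Lbar I)
      (fun i => DiffAlg.prolongationIdeal Lbar (P i)) := by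
  subst hI
  exact lemmal_general hC.1.isPartiallyAutoreduced DiffAlg.separants_subset_initSep
    (DiffAlg.isDifferential_diffSpan d _) (DiffAlg.subset_diffSpan d _) hL.1 hL.2.1
    hP.isMinimalPrimeDecomposition
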